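/- Let $f:\mathbb{R}^{m}\times\mathbb{R}^{n}\to\mathbb{R}$, $(x,y)\mapsto f(x,y)$, be twice continuously differentiable and $\gamma$-smooth for some $\gamma\ge 0$, i.e. $\|\nabla f(z)-\nabla f(w)\|\le\gamma\|z-w\|$ for all $z,w\in\mathbb{R}^{m}\times\mathbb{R}^{n}$, where $\|\cdot\|$ is the Euclidean norm. Let $\alpha\ge 0$ and $\eta>\gamma$, and suppose that $f$ satisfies the $\alpha$-interaction dominance condition with parameter $\eta$, i.e. at every point of $\mathbb{R}^{m}\times\mathbb{R}^{n}$ \begin{align*} \nabla_{xx}^2f + \nabla_{xy}^2f\,(\eta I - \nabla_{yy}^2f)^{-1}\,\nabla_{yx}^2f &\succeq \alpha I, \\ -\nabla_{yy}^2f + \nabla_{yx}^2f\,(\eta I + \nabla_{xx}^2f)^{-1}\,\nabla_{xy}^2f &\succeq \alpha I, \end{align*} where $S\succeq T$ means that $S-T$ is symmetric positive semidefinite. Let $F:=(\nabla_x f,-\nabla_y f)$ be the saddle gradient operator of $f$. Then $F$ is $-\frac1\eta$-comonotone, i.e. $$\langle F(z)-F(w),\,z-w\rangle\ \ge\ -\frac1\eta\,\|F(z)-F(w)\|^2\qquad\text{for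 all } z,w\in\mathbb{R}^{m}\times\mathbb{R}^{n}.$$ In particular, $F$ is negatively comonotone: it is $\rho$-comonotone (the inequality above with $\rho$ in place of $-\frac1\eta$) for some $\rho<0$. -/

import Mathlib

noncomputable section

section SaddleDefinitions

variable {E F : Type*} [NormedAddCommGroup E] [InnerProductSpace ℝ E] [CompleteSpace E]
  [NormedAddCommGroup F] [InnerProductSpace ℝ F] [CompleteSpace F]

/-- The point `z = (x, y)` of `E × F`. The product `WithLp 2 (E × F)` carries the Euclidean
(not the sup) norm, `‖(x, y)‖² = ‖x‖² + ‖y‖²`. -/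
def mkPair (x : E) (y : F) : WithLp 2 (E × F) := WithLp.toLp 2 (x, y)

/-- The partial gradient `∇ₓ f (z)`. -/
def gradX (f : WithLp 2 (E × F) → ℝ) (z : WithLp 2 (E × F)) : E :=
  gradient (fun x => f (mkPair x z.snd)) z.fst

/-- The partial gradient `∇_y f (z)`. -/
def gradY (f : WithLp 2 (E × F) → ℝ) (z : WithLp 2 (E × F)) : F :=
  gradient (fun y => f (mkPair z.fst y)) z.snd

/-- The saddle gradient operator `(∇ₓ f, -∇_y f)`. -/
def saddleGradient (f : WithLp 2 (E × F) → ℝ) (z : WithLp 2 (E × F)) : WithLp 2 (E × F) :=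
  mkPair (gradX f z) (-gradY f z)

/-- The Hessian block `∇²ₓₓ f (z)`, the derivative of `∇ₓ f` with respect to `x`. -/
def hessXX (f : WithLp 2 (E × F) → ℝ) (z : WithLp 2 (E × F)) : E →L[ℝ] E :=
  fderiv ℝ (fun x => gradX f (mkPair x z.snd)) z.fst

/-- The Hessian block `∇²_{xy} f (z)`, the derivative of `∇ₓ f` with respect
to `y`. -/
def hessXY (f : WithLp 2 (E × F) → ℝ) (z : WithLp 2 (E × F)) : F →L[ℝ] E :=
  fderiv ℝ (fun y => gradX f (mkPair z.fst y)) z.snd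

/-- The Hessian block `∇²_{yx} f (z)`, the derivative of `∇_y f` with respect
to `x`. -/
def hessYX (f : WithLp 2 (E × F) → ℝ) (z : WithLp 2 (E × F)) : E →L[ℝ] F :=
  fderiv ℝ (fun x => gradY f (mkPair x z.snd)) z.fst

/-- The Hessian block `∇²_{yy} f (z)`, the derivative of `∇_y f` with respect to `y`. -/
def hessYY (f : WithLp 2 (E × F) → ℝ) (z : WithLp 2 (E × F)) : F →L[ℝ] F :=
  fderiv ℝ (fun y => gradY f (mkPair z.fst y)) z.snd

/-- `f` is `γ`-smooth: it is differentiable with `γ`-Lipschitz gradient (Euclidean norms). -/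
def IsGradLipschitz (γ : ℝ) (f : WithLp 2 (E × F) → ℝ) : Prop :=
  Differentiable ℝ f ∧ ∀ z w : WithLp 2 (E × F), ‖gradient f z - gradient f w‖ ≤ γ * ‖z - w‖

/-- The `α`-interaction dominance condition with parameter `η`, at every point `z`. The order
on operators is the Loewner order: `S ≤ T` iff `T - S` is positive semidefinite. The inverses
are genuine ones when the norms of `∇²ₓₓ f` and `∇²_{yy} f` are less than `η`, in particular
when `f` is `γ`-smooth with `γ < η`. -/
def InteractionDominant (α η : ℝ) (f : WithLp 2 (E × F) → ℝ) : Prop :=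
  ∀ z : WithLp 2 (E × F),
    α • ContinuousLinearMap.id ℝ E ≤
        hessXX f z + hessXY f z ∘L
          (η • ContinuousLinearMap.id ℝ F - hessYY f z).inverse ∘L hessYX f z ∧
    α • ContinuousLinearMap.id ℝ F ≤
        -hessYY f z + hessYX f z ∘L
          (η • ContinuousLinearMap.id ℝ E + hessXX f z).inverse ∘L hessXY f z

/-- `T` is `ρ`-comonotone: `⟨T z - T w, z - w⟩ ≥ ρ ‖T z - T w‖²` for all `z, w`. -/
def IsComonotone {H : Type*} [NormedAddCommGroup H] [InnerProductSpace ℝ H] (ρ : ℝ)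
    (T : H → H) : Prop :=
  ∀ z w : H, ρ * ‖T z - T w‖ ^ 2 ≤ inner ℝ (T z - T w) (z - w)

/-- `T` is negatively comonotone: it is `ρ`-comonotone for some `ρ < 0`. -/
def IsNegComonotone {H : Type*} [NormedAddCommGroup H] [InnerProductSpace ℝ H]
    (T : H → H) : Prop :=
  ∃ ρ : ℝ, ρ < 0 ∧ IsComonotone ρ T

end SaddleDefinitions

end

open scoped InnerProductSpace

/-! ### Linear algebra of the saddle Jacobian. -/

section PositiveOperators

variable {E F : Type*} [NormedAddCommGroup E] [InnerProductSpace ℝ E] [FiniteDimensional ℝ E]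
  [NormedAddCommGroup F] [InnerProductSpace ℝ F] [FiniteDimensional ℝ F]

/-! Write `J` for the derivative of the saddle gradient `T` and put `Φ = id + η⁻¹ T`. Comonotonicity
with constant `-1/η` says `⟪T z - T w, Φ z - Φ w⟫ ≥ 0`. Since `T` is `γ`-Lipschitz and `γ < η`, `Φ`
is invertible, so the claim is that `T ∘ Φ⁻¹` is monotone, which follows from the pointwise bound
`⟪J v, η v + J v⟫ ≥ 0` (`isComonotone_of_hasFDerivAt`). Integrating that bound along the segment
from `w` to `z` itself would fail: by convexity, averaging `‖J v‖²` errs in the wrong direction.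

The pointwise bound is `inner_saddle_add_norm_sq_nonneg`. Split `(η + J)(a, b) = (p, q)` into `(p,
0)` and `(0, q)` and solve each by block elimination. The Schur complements that appear are the two
interaction dominance operators, positive semidefinite as `α ≥ 0`. The cross terms cancel because
`J` is a symmetric Hessian with its second row negated. -/

theorem ContinuousLinearMap.isInvertible_of_inner_pos (T : E →L[ℝ] E)
    (hT : ∀ a, a ≠ 0 → 0 < ⟪T a, a⟫_ℝ) : T.IsInvertible := by
  have hinj : Function.Injective (T : E →ₗ[ℝ] E) := by
    rw [injective_iff_map_eq_zero]
    intro a ha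
    by_contra hne
    have := hT a hne
    rw [show T a = 0 from ha, inner_zero_left] at this
    exact lt_irrefl _ this
  exact ⟨(LinearEquiv.ofInjectiveEndo (T : E →ₗ[ℝ] E) hinj).toContinuousLinearEquiv, by ext; rfl⟩

omit [FiniteDimensional ℝ E] in
theorem ContinuousLinearMap.IsInvertible.apply_inverse_apply {T : E →L[ℝ] E} (hT : T.IsInvertible)
    (a : E) : T (T.inverse a) = a :=
  ((hT.inverse_apply_eq (x := T.inverse a) (y := a)).1 rfl).symm

theorem ContinuousLinearMap.exists_smul_add_apply_eq (S : E →L[ℝ] E) {η : ℝ} (hη : 0 < η)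
    (hS : ∀ a, 0 ≤ ⟪S a, a⟫_ℝ) (p : E) : ∃ a, η • a + S a = p := by
  have hinv : (η • ContinuousLinearMap.id ℝ E + S).IsInvertible := by
    apply ContinuousLinearMap.isInvertible_of_inner_pos
    intro a ha
    have h1 : 0 < ⟪a, a⟫_ℝ := real_inner_self_pos.2 ha
    simp only [add_apply, smul_apply, id_apply, inner_add_left, real_inner_smul_left]
    have := hS a
    positivity
  exact ⟨_, by simpa using hinv.apply_inverse_apply p⟩

/-- The Schur complement form of negative comonotonicity for a linear saddle operator
`(a, b) ↦ (A a + B b, -(B' a + C b))` whose off-diagonal blocks are adjoint to each other. -/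
theorem inner_saddle_add_norm_sq_nonneg {A : E →L[ℝ] E} {B : F →L[ℝ] E} {B' : E →L[ℝ] F}
    {C : F →L[ℝ] F} {η : ℝ} (hη : 0 < η)
    (hA : ∀ u v, ⟪A u, v⟫_ℝ = ⟪u, A v⟫_ℝ) (hC : ∀ u v, ⟪C u, v⟫_ℝ = ⟪u, C v⟫_ℝ)
    (hB : ∀ a b, ⟪B b, a⟫_ℝ = ⟪b, B' a⟫_ℝ)
    (hP : ∀ a, a ≠ 0 → 0 < ⟪(η • ContinuousLinearMap.id ℝ E + A) a, a⟫_ℝ)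
    (hQ : ∀ b, b ≠ 0 → 0 < ⟪(η • ContinuousLinearMap.id ℝ F - C) b, b⟫_ℝ)
    (hS : ∀ a, 0 ≤
      ⟪(A + B ∘L (η • ContinuousLinearMap.id ℝ F - C).inverse ∘L B') a, a⟫_ℝ)
    (hR : ∀ b, 0 ≤
      ⟪(-C + B' ∘L (η • ContinuousLinearMap.id ℝ E + A).inverse ∘L B) b, b⟫_ℝ)
    (a : E) (b : F) :
    0 ≤ ⟪A a + B b, η • a + (A a + B b)⟫_ℝ + ⟪-(B' a + C b), η • b + -(B' a + C b)⟫_ℝ := by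
  set P := η • ContinuousLinearMap.id ℝ E + A with hPdef
  set Q := η • ContinuousLinearMap.id ℝ F - C with hQdef
  set S := A + B ∘L Q.inverse ∘L B' with hSdef
  set R := -C + B' ∘L P.inverse ∘L B with hRdef
  obtain ⟨p, hp⟩ : ∃ p, p = η • a + (A a + B b) := ⟨_, rfl⟩
  obtain ⟨q, hq⟩ : ∃ q, q = η • b + -(B' a + C b) := ⟨_, rfl⟩
  -- With `b₁` and `a₂` below, `η + J` sends `(a₁, b₁)` to `(p, 0)` and `(a₂, b₂)` to `(0, q)`.
  obtain ⟨a₁, ha₁⟩ := S.exists_smul_add_apply_eq hη hS p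
  obtain ⟨b₂, hb₂⟩ := R.exists_smul_add_apply_eq hη hR q
  obtain ⟨b₁, hb₁⟩ : ∃ b₁, b₁ = Q.inverse (B' a₁) := ⟨_, rfl⟩
  obtain ⟨a₂, ha₂⟩ : ∃ a₂, a₂ = -P.inverse (B b₂) := ⟨_, rfl⟩
  have hQb₁ : η • b₁ - C b₁ = B' a₁ := by
    -- Positivity makes `Q.inverse` a true inverse, not the default value `0`.
    have := (Q.isInvertible_of_inner_pos hQ).apply_inverse_apply (B' a₁)
    rw [← hb₁] at this
    simpa [hQdef] using this
  have hPa₂ : η • a₂ + A a₂ = -B b₂ := by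
    have := (P.isInvertible_of_inner_pos hP).apply_inverse_apply (B b₂)
    rw [show P.inverse (B b₂) = -a₂ by rw [ha₂, neg_neg], map_neg] at this
    rw [← this]
    simp [hPdef]
  have hSa₁ : S a₁ = A a₁ + B b₁ := by simp [hSdef, hb₁]
  have hRb₂ : R b₂ = -C b₂ - B' a₂ := by simp [hRdef, ha₂]
  -- `η + J` is injective: on a kernel vector the off-diagonal terms cancel, leaving a zero sum of
  -- two positive definite forms.
  have hdecomp : a - (a₁ + a₂) = 0 ∧ b - (b₁ + b₂) = 0 := by
    obtain ⟨u, hu⟩ : ∃ u, u = a - (a₁ + a₂) := ⟨_, rfl⟩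
    obtain ⟨v, hv⟩ : ∃ v, v = b - (b₁ + b₂) := ⟨_, rfl⟩
    have h1 : P u = -B v := by
      rw [hSa₁, hp] at ha₁
      simp only [hPdef, hu, hv, add_apply, smul_apply,
        ContinuousLinearMap.id_apply, map_sub, map_add]
      linear_combination (norm := module) -ha₁ - hPa₂
    have h2 : Q v = B' u := by
      rw [hRb₂, hq] at hb₂
      simp only [hQdef, hu, hv, sub_apply, smul_apply,
        ContinuousLinearMap.id_apply, map_sub, map_add]
      linear_combination (norm := module) -hb₂ - hQb₁
    have h3 : ⟪P u, u⟫_ℝ + ⟪Q v, v⟫_ℝ = 0 := by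
      rw [h1, h2, inner_neg_left, hB, real_inner_comm v]
      ring
    have hPu : u ≠ 0 → 0 < ⟪P u, u⟫_ℝ := hP u
    have hQv : v ≠ 0 → 0 < ⟪Q v, v⟫_ℝ := hQ v
    rw [← hu, ← hv]
    by_cases hu0 : u = 0
    · refine ⟨hu0, ?_⟩
      by_contra hv0
      have := hQv hv0
      rw [hu0] at h3
      simp only [inner_zero_right] at h3
      linarith
    · exfalso
      have h4 := hPu hu0
      by_cases hv0 : v = 0
      · rw [hv0] at h3
        simp only [inner_zero_right] at h3
        linarith
      · have := hQv hv0
        linarith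
  have ha : a = a₁ + a₂ := sub_eq_zero.1 hdecomp.1
  have hb : b = b₁ + b₂ := sub_eq_zero.1 hdecomp.2
  have hcross : ⟪a₂, p⟫_ℝ + ⟪b₁, q⟫_ℝ = 0 := by
    rw [← ha₁, ← hb₂, hSa₁, hRb₂]
    have e1 : ⟪η • a₂ + A a₂, a₁⟫_ℝ = -⟪B b₂, a₁⟫_ℝ := by rw [hPa₂, inner_neg_left]
    have e2 : ⟪η • b₁ - C b₁, b₂⟫_ℝ = ⟪B' a₁, b₂⟫_ℝ := by rw [hQb₁]
    have e3 := hB a₁ b₂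
    have e4 := hB a₂ b₁
    have e5 := real_inner_comm (B' a₁) b₂
    have e6 := real_inner_comm (B b₁) a₂
    have e7 := hA a₂ a₁
    have e8 := hC b₁ b₂
    simp only [inner_add_left, inner_add_right, inner_sub_left, inner_sub_right,
      real_inner_smul_left, real_inner_smul_right, inner_neg_right] at e1 e2 ⊢
    linarith
  -- As `p = η a₁ + S a₁`, this quantity is `⟪S a₁, p⟫`.
  have diag₁ : 0 ≤ ⟪p, p⟫_ℝ - η * ⟪a₁, p⟫_ℝ := by
    have h1 : ⟪p, p⟫_ℝ - η * ⟪a₁, p⟫_ℝ = η * ⟪S a₁, a₁⟫_ℝ + ⟪S a₁, S a₁⟫_ℝ := by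
      rw [← ha₁]
      simp only [inner_add_left, inner_add_right, real_inner_smul_left, real_inner_smul_right]
      ring
    rw [h1]
    have := hS a₁
    have := real_inner_self_nonneg (x := S a₁)
    positivity
  have diag₂ : 0 ≤ ⟪q, q⟫_ℝ - η * ⟪b₂, q⟫_ℝ := by
    have h1 : ⟪q, q⟫_ℝ - η * ⟪b₂, q⟫_ℝ = η * ⟪R b₂, b₂⟫_ℝ + ⟪R b₂, R b₂⟫_ℝ := by
      rw [← hb₂]
      simp only [inner_add_left, inner_add_right, real_inner_smul_left, real_inner_smul_right]
      ring
    rw [h1]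
    have := hR b₂
    have := real_inner_self_nonneg (x := R b₂)
    positivity
  have hpa : A a + B b = p - η • a := by rw [hp]; abel
  have hqb : -(B' a + C b) = q - η • b := by rw [hq]; abel
  rw [← hp, ← hq, hpa, hqb, inner_sub_left, inner_sub_left, real_inner_smul_left,
    real_inner_smul_left, ha, hb, inner_add_left, inner_add_left]
  linear_combination diag₁ + diag₂ + η * hcross

end PositiveOperators

/-! ### From the pointwise bound to comonotonicity. -/

section Comonotone

variable {H : Type*} [NormedAddCommGroup H] [InnerProductSpace ℝ H] [CompleteSpace H]

/-- A Lipschitz operator whose derivatives are all `-1/η`-comonotone is itself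
`-1/η`-comonotone, if `η` exceeds its Lipschitz constant. -/
theorem isComonotone_of_hasFDerivAt {T : H → H} {D : H → H →L[ℝ] H} {γ η : ℝ} (hγ : 0 ≤ γ)
    (hη : γ < η) (hT : ∀ z, HasFDerivAt T (D z) z)
    (hlip : ∀ z w, ‖T z - T w‖ ≤ γ * ‖z - w‖)
    (hD : ∀ z v, 0 ≤ ⟪D z v, η • v + D z v⟫_ℝ) : IsComonotone (-(1 / η)) T := by
  have hη0 : 0 < η := hγ.trans_lt hη
  have hDnorm : ∀ z, ‖D z‖ ≤ γ := fun z =>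
    (hT z).le_of_lip' hγ (Filter.Eventually.of_forall fun x => hlip x z)
  have hlt : η⁻¹ * γ < 1 := by rwa [inv_mul_lt_iff₀ hη0, mul_one]
  have hc : ((η⁻¹ * γ).toNNReal : ℝ) = η⁻¹ * γ := Real.coe_toNNReal _ (by positivity)
  -- A perturbation of the identity with Lipschitz constant below 1 is a homeomorphism.
  have happrox : ApproximatesLinearOn (fun z => z + η⁻¹ • T z)
      (ContinuousLinearEquiv.refl ℝ H : H →L[ℝ] H) Set.univ (η⁻¹ * γ).toNNReal := by
    intro x _ y _
    have h1 : x + η⁻¹ • T x - (y + η⁻¹ • T y) - (x - y) = η⁻¹ • (T x - T y) := by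
      rw [smul_sub]; abel
    simp only [ContinuousLinearEquiv.coe_refl, ContinuousLinearMap.id_apply, h1, norm_smul,
      norm_inv, Real.norm_eq_abs, abs_of_pos hη0, hc]
    rw [mul_assoc]
    exact mul_le_mul_of_nonneg_left (hlip x y) (by positivity)
  have hsmall : Subsingleton H ∨ (η⁻¹ * γ).toNNReal <
      ‖((ContinuousLinearEquiv.refl ℝ H).symm : H →L[ℝ] H)‖₊⁻¹ := by
    rcases subsingleton_or_nontrivial H with h | h
    · exact Or.inl h
    · right
      rw [← NNReal.coe_lt_coe, hc]
      simpa using hlt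
  let Φ : H ≃ₜ H := happrox.toHomeomorph _ hsmall
  have hΦ : ∀ z, Φ z = z + η⁻¹ • T z := fun z => rfl
  -- Neumann series, as `‖η⁻¹ D z‖ < 1`; this makes `Φ⁻¹` differentiable.
  have hequiv : ∀ z, ∃ e : H ≃L[ℝ] H,
      (e : H →L[ℝ] H) = ContinuousLinearMap.id ℝ H + η⁻¹ • D z := by
    intro z
    have hn : ‖-(η⁻¹ • D z)‖ < 1 := by
      rw [norm_neg, norm_smul, norm_inv, Real.norm_eq_abs, abs_of_pos hη0]
      exact (mul_le_mul_of_nonneg_left (hDnorm z) (by positivity)).trans_lt hlt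
    refine ⟨ContinuousLinearEquiv.ofUnit (Units.oneSub _ hn), ?_⟩
    ext v
    change ((Units.oneSub _ hn : (H →L[ℝ] H)ˣ) : H →L[ℝ] H) v = _
    simp
  choose e he using hequiv
  have hΦ' : ∀ z, HasFDerivAt Φ (e z : H →L[ℝ] H) z := by
    intro z
    rw [he]
    exact (hasFDerivAt_id z).add ((hT z).const_smul η⁻¹)
  have hΨ' : ∀ p, HasFDerivAt Φ.symm ((e (Φ.symm p)).symm : H →L[ℝ] H) p := fun p =>
    HasFDerivAt.of_local_left_inverse Φ.symm.continuous.continuousAt (hΦ' _)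
      (Filter.Eventually.of_forall Φ.apply_symm_apply)
  intro z w
  let d := Φ z - Φ w
  -- The path is straight in the image of `Φ`, so `d` stays constant.
  let g : ℝ → ℝ := fun t => ⟪T (Φ.symm (Φ w + t • d)), d⟫_ℝ
  have hg : ∀ t, HasDerivAt g
      ⟪D (Φ.symm (Φ w + t • d)) ((e (Φ.symm (Φ w + t • d))).symm d), d⟫_ℝ t := by
    intro t
    have h1 : HasDerivAt (fun t : ℝ => Φ w + t • d) d t := by
      simpa using ((hasDerivAt_id t).smul_const d).const_add (Φ w)
    have h2 := ((hT _).comp _ (hΨ' (Φ w + t • d))).comp_hasDerivAt t h1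
    simpa using h2.inner ℝ (hasDerivAt_const t d)
  have hmono : Monotone g := by
    refine monotone_of_hasDerivAt_nonneg hg fun t => ?_
    generalize Φ.symm (Φ w + t • d) = x
    have hd : d = η⁻¹ • (η • (e x).symm d + D x ((e x).symm d)) := by
      rw [smul_add, inv_smul_smul₀ hη0.ne']
      have := (e x).apply_symm_apply d
      rw [← ContinuousLinearEquiv.coe_coe, he] at this
      simpa using this.symm
    generalize (e x).symm d = v at hd ⊢
    rw [hd, real_inner_smul_right]
    exact mul_nonneg (by positivity) (hD x v)
  have h01 := hmono zero_le_one
  simp only [g, zero_smul, add_zero, one_smul, d, add_sub_cancel, Φ.symm_apply_apply] at h01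
  rw [← sub_nonneg, ← inner_sub_left, hΦ, hΦ,
    show z + η⁻¹ • T z - (w + η⁻¹ • T w) = (z - w) + η⁻¹ • (T z - T w) by rw [smul_sub]; abel,
    inner_add_right, real_inner_smul_right, real_inner_self_eq_norm_sq] at h01
  rw [one_div]
  linarith

end Comonotone

/-! ### Partial gradients and Hessian blocks. -/

section SaddleCalculus

variable {E F : Type*} [NormedAddCommGroup E] [InnerProductSpace ℝ E] [CompleteSpace E]
  [NormedAddCommGroup F] [InnerProductSpace ℝ F] [CompleteSpace F]

omit [CompleteSpace E] [CompleteSpace F] in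
theorem hasFDerivAt_mkPair_left (x : E) (y : F) :
    HasFDerivAt (fun x => mkPair x y)
      (((WithLp.prodContinuousLinearEquiv 2 ℝ E F).symm : E × F →L[ℝ] WithLp 2 (E × F)) ∘L
        ContinuousLinearMap.inl ℝ E F) x :=
  ((WithLp.prodContinuousLinearEquiv 2 ℝ E F).symm : E × F →L[ℝ] WithLp 2 (E × F)).hasFDerivAt.comp
    x (hasFDerivAt_prodMk_left x y)

omit [CompleteSpace E] [CompleteSpace F] in
theorem hasFDerivAt_mkPair_right (x : E) (y : F) :
    HasFDerivAt (fun y => mkPair x y)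
      (((WithLp.prodContinuousLinearEquiv 2 ℝ E F).symm : E × F →L[ℝ] WithLp 2 (E × F)) ∘L
        ContinuousLinearMap.inr ℝ E F) y :=
  ((WithLp.prodContinuousLinearEquiv 2 ℝ E F).symm : E × F →L[ℝ] WithLp 2 (E × F)).hasFDerivAt.comp
    y (hasFDerivAt_prodMk_right x y)

theorem gradX_eq_gradient_fst {f : WithLp 2 (E × F) → ℝ} {z : WithLp 2 (E × F)}
    (hf : DifferentiableAt ℝ f z) : gradX f z = (gradient f z).fst := by
  apply HasGradientAt.gradient
  rw [hasGradientAt_iff_hasFDerivAt]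
  have h := HasFDerivAt.comp z.fst (f := fun x => mkPair x z.snd) (g := f)
    hf.hasGradientAt.hasFDerivAt (hasFDerivAt_mkPair_left z.fst z.snd)
  refine h.congr_fderiv ?_
  ext v
  change ⟪gradient f z, mkPair v 0⟫_ℝ = ⟪_, v⟫_ℝ
  rw [WithLp.prod_inner_apply]
  simp [mkPair]

theorem gradY_eq_gradient_snd {f : WithLp 2 (E × F) → ℝ} {z : WithLp 2 (E × F)}
    (hf : DifferentiableAt ℝ f z) : gradY f z = (gradient f z).snd := by
  apply HasGradientAt.gradient
  rw [hasGradientAt_iff_hasFDerivAt]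
  have h := HasFDerivAt.comp z.snd (f := fun y => mkPair z.fst y) (g := f)
    hf.hasGradientAt.hasFDerivAt (hasFDerivAt_mkPair_right z.fst z.snd)
  refine h.congr_fderiv ?_
  ext v
  change ⟪gradient f z, mkPair 0 v⟫_ℝ = ⟪_, v⟫_ℝ
  rw [WithLp.prod_inner_apply]
  simp [mkPair]

theorem ContDiff.differentiable_gradient {H : Type*} [NormedAddCommGroup H]
    [InnerProductSpace ℝ H] [CompleteSpace H] {f : H → ℝ} (hf : ContDiff ℝ 2 f) :
    Differentiable ℝ (gradient f) := by
  have h : Differentiable ℝ (fderiv ℝ f) :=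
    (hf.fderiv_right (m := 1) (by norm_num)).differentiable one_ne_zero
  exact ((InnerProductSpace.toDual ℝ H).symm.differentiable).comp h

/-- Symmetry of the second derivative, carried through the Riesz isomorphism. -/
theorem inner_fderiv_gradient_comm {H : Type*} [NormedAddCommGroup H]
    [InnerProductSpace ℝ H] [CompleteSpace H] {f : H → ℝ} (hf : ContDiff ℝ 2 f) (z u v : H) :
    ⟪fderiv ℝ (gradient f) z u, v⟫_ℝ = ⟪u, fderiv ℝ (gradient f) z v⟫_ℝ := by
  have key : ∀ u v, fderiv ℝ (fderiv ℝ f) z u v = ⟪fderiv ℝ (gradient f) z u, v⟫_ℝ := by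
    intro u v
    have h1 : HasFDerivAt (fun x => fderiv ℝ f x v)
        (ContinuousLinearMap.apply ℝ ℝ v ∘L fderiv ℝ (fderiv ℝ f) z) z :=
      (ContinuousLinearMap.apply ℝ ℝ v).hasFDerivAt.comp z
        (((hf.fderiv_right (m := 1) (by norm_num)).differentiable one_ne_zero) z).hasFDerivAt
    have h2 : HasFDerivAt (fun x => ⟪v, gradient f x⟫_ℝ)
        (innerSL ℝ v ∘L fderiv ℝ (gradient f) z) z :=
      (innerSL ℝ v).hasFDerivAt.comp z (hf.differentiable_gradient z).hasFDerivAt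
    have h3 : (fun x => fderiv ℝ f x v) = fun x => ⟪v, gradient f x⟫_ℝ := by
      funext x
      rw [← toDual_gradient, InnerProductSpace.toDual_apply_apply, real_inner_comm]
    rw [h3] at h1
    rw [real_inner_comm]
    exact DFunLike.congr_fun (h1.unique h2) u
  rw [← key, real_inner_comm, ← key]
  exact hf.contDiffAt.isSymmSndFDerivAt (by simp) u v

theorem fst_fderiv_gradient_apply {f : WithLp 2 (E × F) → ℝ} (hf : ContDiff ℝ 2 f)
    (z : WithLp 2 (E × F)) (a : E) (b : F) :
    (fderiv ℝ (gradient f) z (mkPair a b)).fst = hessXX f z a + hessXY f z b := by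
  have hfd : Differentiable ℝ f := hf.differentiable two_ne_zero
  have hG := (hf.differentiable_gradient z).hasFDerivAt
  have hfst := ((WithLp.fstL 2 ℝ E F).hasFDerivAt (x := gradient f z)).comp z hG
  have hgrad : ∀ z, gradX f z = (gradient f z).fst := fun z => gradX_eq_gradient_fst (hfd z)
  have hx := HasFDerivAt.comp z.fst (f := fun x => mkPair x z.snd) hfst
    (hasFDerivAt_mkPair_left z.fst z.snd)
  have hy := HasFDerivAt.comp z.snd (f := fun y => mkPair z.fst y) hfst
    (hasFDerivAt_mkPair_right z.fst z.snd)
  have hxx := (hx.congr_of_eventuallyEq (Filter.Eventually.of_forall fun _ => hgrad _)).fderiv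
  have hxy := (hy.congr_of_eventuallyEq (Filter.Eventually.of_forall fun _ => hgrad _)).fderiv
  have hab : mkPair a b = mkPair a 0 + mkPair 0 b := by simp [mkPair, ← WithLp.toLp_add]
  rw [hab, map_add, show hessXX f z = _ from hxx, show hessXY f z = _ from hxy]
  rfl

theorem snd_fderiv_gradient_apply {f : WithLp 2 (E × F) → ℝ} (hf : ContDiff ℝ 2 f)
    (z : WithLp 2 (E × F)) (a : E) (b : F) :
    (fderiv ℝ (gradient f) z (mkPair a b)).snd = hessYX f z a + hessYY f z b := by
  have hfd : Differentiable ℝ f := hf.differentiable two_ne_zero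
  have hG := (hf.differentiable_gradient z).hasFDerivAt
  have hsnd := ((WithLp.sndL 2 ℝ E F).hasFDerivAt (x := gradient f z)).comp z hG
  have hgrad : ∀ z, gradY f z = (gradient f z).snd := fun z => gradY_eq_gradient_snd (hfd z)
  have hx := HasFDerivAt.comp z.fst (f := fun x => mkPair x z.snd) hsnd
    (hasFDerivAt_mkPair_left z.fst z.snd)
  have hy := HasFDerivAt.comp z.snd (f := fun y => mkPair z.fst y) hsnd
    (hasFDerivAt_mkPair_right z.fst z.snd)
  have hyx := (hx.congr_of_eventuallyEq (Filter.Eventually.of_forall fun _ => hgrad _)).fderiv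
  have hyy := (hy.congr_of_eventuallyEq (Filter.Eventually.of_forall fun _ => hgrad _)).fderiv
  have hab : mkPair a b = mkPair a 0 + mkPair 0 b := by simp [mkPair, ← WithLp.toLp_add]
  rw [hab, map_add, show hessYX f z = _ from hyx, show hessYY f z = _ from hyy]
  rfl

/-- The reflection `(x, y) ↦ (x, -y)`. -/
def negSnd (E F : Type*) [NormedAddCommGroup E] [InnerProductSpace ℝ E]
    [NormedAddCommGroup F] [InnerProductSpace ℝ F] : WithLp 2 (E × F) →L[ℝ] WithLp 2 (E × F) :=
  ((WithLp.prodContinuousLinearEquiv 2 ℝ E F).symm : E × F →L[ℝ] WithLp 2 (E × F)) ∘L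
    (WithLp.fstL 2 ℝ E F).prod (-WithLp.sndL 2 ℝ E F)

omit [CompleteSpace E] [CompleteSpace F] in
theorem negSnd_apply (z : WithLp 2 (E × F)) : negSnd E F z = mkPair z.fst (-z.snd) := rfl

omit [CompleteSpace E] [CompleteSpace F] in
theorem norm_negSnd (z : WithLp 2 (E × F)) : ‖negSnd E F z‖ = ‖z‖ := by
  simp [negSnd_apply, mkPair, WithLp.prod_norm_eq_of_L2]

theorem saddleGradient_eq_negSnd_gradient {f : WithLp 2 (E × F) → ℝ} (hf : Differentiable ℝ f)
    (z : WithLp 2 (E × F)) : saddleGradient f z = negSnd E F (gradient f z) := by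
  rw [saddleGradient, gradX_eq_gradient_fst (hf z), gradY_eq_gradient_snd (hf z), negSnd_apply]

end SaddleCalculus

/-! ### Application to interaction dominant functions. -/

section InteractionDominance

variable {E F : Type*} [NormedAddCommGroup E] [InnerProductSpace ℝ E] [FiniteDimensional ℝ E]
  [CompleteSpace E] [NormedAddCommGroup F] [InnerProductSpace ℝ F] [FiniteDimensional ℝ F]
  [CompleteSpace F]

omit [FiniteDimensional ℝ E] [FiniteDimensional ℝ F] in
theorem InteractionDominant.inner_nonneg {f : WithLp 2 (E × F) → ℝ} {α η : ℝ} (hα : 0 ≤ α)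
    (hdom : InteractionDominant α η f) (z : WithLp 2 (E × F)) :
    (∀ a, 0 ≤ ⟪(hessXX f z + hessXY f z ∘L
      (η • ContinuousLinearMap.id ℝ F - hessYY f z).inverse ∘L hessYX f z) a, a⟫_ℝ) ∧
    ∀ b, 0 ≤ ⟪(-hessYY f z + hessYX f z ∘L
      (η • ContinuousLinearMap.id ℝ E + hessXX f z).inverse ∘L hessXY f z) b, b⟫_ℝ := by
  constructor
  · intro a
    have h := ((ContinuousLinearMap.le_def _ _).1 (hdom z).1).inner_nonneg_left a
    rw [sub_apply, inner_sub_left, smul_apply,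
      ContinuousLinearMap.id_apply, real_inner_smul_left] at h
    have := mul_nonneg hα (real_inner_self_nonneg (x := a))
    linarith
  · intro b
    have h := ((ContinuousLinearMap.le_def _ _).1 (hdom z).2).inner_nonneg_left b
    rw [sub_apply, inner_sub_left, smul_apply,
      ContinuousLinearMap.id_apply, real_inner_smul_left] at h
    have := mul_nonneg hα (real_inner_self_nonneg (x := b))
    linarith

theorem InteractionDominant.isComonotone_saddleGradient {f : WithLp 2 (E × F) → ℝ} {γ α η : ℝ}
    (hγ : 0 ≤ γ) (hα : 0 ≤ α) (hη : γ < η) (hf : ContDiff ℝ 2 f) (hsmooth : IsGradLipschitz γ f)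
    (hdom : InteractionDominant α η f) : IsComonotone (-(1 / η)) (saddleGradient f) := by
  have hη0 : 0 < η := hγ.trans_lt hη
  have hsaddle : saddleGradient f = fun z => negSnd E F (gradient f z) :=
    funext (saddleGradient_eq_negSnd_gradient hsmooth.1)
  have hG := fun z => (hf.differentiable_gradient z).hasFDerivAt
  refine isComonotone_of_hasFDerivAt (D := fun z => negSnd E F ∘L fderiv ℝ (gradient f) z)
    hγ hη ?_ ?_ ?_
  · intro z
    rw [hsaddle]
    exact (negSnd E F).hasFDerivAt.comp z (hG z)
  · intro z w
    simp only [hsaddle]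
    rw [← map_sub, norm_negSnd]
    exact hsmooth.2 z w
  · intro z v
    obtain ⟨a, b, rfl⟩ : ∃ a b, v = mkPair a b := ⟨v.fst, v.snd, rfl⟩
    have hnorm : ‖fderiv ℝ (gradient f) z‖ ≤ γ :=
      (hG z).le_of_lip' hγ (Filter.Eventually.of_forall fun x => hsmooth.2 x z)
    have hsymm := inner_fderiv_gradient_comm hf z
    have hinner : ∀ a b a' b', ⟪fderiv ℝ (gradient f) z (mkPair a b), mkPair a' b'⟫_ℝ =
        ⟪hessXX f z a + hessXY f z b, a'⟫_ℝ + ⟪hessYX f z a + hessYY f z b, b'⟫_ℝ := by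
      intro a b a' b'
      rw [WithLp.prod_inner_apply, ← fst_fderiv_gradient_apply hf,
        ← snd_fderiv_gradient_apply hf]
      rfl
    have hblock : ∀ a b a' b',
        ⟪hessXX f z a + hessXY f z b, a'⟫_ℝ + ⟪hessYX f z a + hessYY f z b, b'⟫_ℝ =
        ⟪a, hessXX f z a' + hessXY f z b'⟫_ℝ + ⟪b, hessYX f z a' + hessYY f z b'⟫_ℝ := by
      intro a b a' b'
      rw [← hinner, hsymm, real_inner_comm, hinner, real_inner_comm a, real_inner_comm b]
    -- Restricted to each factor, this and `γ < η` make `η + ∇²ₓₓ f` and `η - ∇²_{yy} f` positive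
    -- definite.
    have hquad : ∀ v, |⟪fderiv ℝ (gradient f) z v, v⟫_ℝ| ≤ γ * ‖v‖ ^ 2 := by
      intro v
      calc _ ≤ ‖fderiv ℝ (gradient f) z v‖ * ‖v‖ := abs_real_inner_le_norm _ _
        _ ≤ γ * ‖v‖ * ‖v‖ := by
          gcongr
          exact (fderiv ℝ (gradient f) z).le_of_opNorm_le hnorm v
        _ = _ := by ring
    have hP : ∀ a, a ≠ 0 → 0 < ⟪(η • ContinuousLinearMap.id ℝ E + hessXX f z) a, a⟫_ℝ := by
      intro a ha
      have h1 := (abs_le.1 (hquad (mkPair a 0))).1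
      rw [hinner] at h1
      have h2 : 0 < ‖a‖ ^ 2 := by positivity
      simp only [map_zero, add_zero, inner_zero_right, mkPair, WithLp.prod_norm_sq_eq_of_L2,
        WithLp.toLp_fst, WithLp.toLp_snd, norm_zero] at h1
      simp only [add_apply, smul_apply,
        ContinuousLinearMap.id_apply, inner_add_left, real_inner_smul_left,
        real_inner_self_eq_norm_sq]
      nlinarith
    have hQ : ∀ b, b ≠ 0 → 0 < ⟪(η • ContinuousLinearMap.id ℝ F - hessYY f z) b, b⟫_ℝ := by
      intro b hb
      have h1 := (abs_le.1 (hquad (mkPair 0 b))).2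
      rw [hinner] at h1
      have h2 : 0 < ‖b‖ ^ 2 := by positivity
      simp only [map_zero, zero_add, inner_zero_right, mkPair, WithLp.prod_norm_sq_eq_of_L2,
        WithLp.toLp_fst, WithLp.toLp_snd, norm_zero] at h1
      simp only [sub_apply, smul_apply,
        ContinuousLinearMap.id_apply, inner_sub_left, real_inner_smul_left,
        real_inner_self_eq_norm_sq]
      nlinarith
    -- Zero entries in `hblock` isolate the symmetry of each diagonal block and the adjointness of
    -- the off-diagonal ones.
    have key := inner_saddle_add_norm_sq_nonneg hη0
      (fun u v => by simpa using hblock u 0 v 0) (fun u v => by simpa using hblock 0 u 0 v)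
      (fun a b => by simpa using hblock 0 b a 0) hP hQ
      (hdom.inner_nonneg hα z).1 (hdom.inner_nonneg hα z).2 a b
    rw [← fst_fderiv_gradient_apply hf, ← snd_fderiv_gradient_apply hf] at key
    rw [WithLp.prod_inner_apply]
    exact key

end InteractionDominance

theorem mainTheorem9 (m n : ℕ)
    (f : WithLp 2 (EuclideanSpace ℝ (Fin m) × EuclideanSpace ℝ (Fin n)) → ℝ) (γ α η : ℝ)
    (hγ : 0 ≤ γ) (hα : 0 ≤ α) (hη : γ < η)
    (hf : ContDiff ℝ 2 f) (hsmooth : IsGradLipschitz γ f)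
    (hdom : InteractionDominant α η f) :
    IsComonotone (-(1 / η)) (saddleGradient f) ∧ IsNegComonotone (saddleGradient f) := by
  have h := hdom.isComonotone_saddleGradient hγ hα hη hf hsmooth
  have hη0 : 0 < η := hγ.trans_lt hη
  exact ⟨h, -(1 / η), by simpa using hη0, h⟩
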